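/- Let $0<p<1$, let $M\in\mathbf R^{n\times n}$ be a deterministic matrix, and let $C$ be a symmetric random $n\times n$ matrix whose entries $C_{ij}$, $i\ge j$, are independent and satisfy $$C_{ij}=\sqrt{\tfrac{1-p}{p}}\ \text{ with probability } p,\qquad C_{ij}=-\sqrt{\tfrac{p}{1-p}}\ \text{ with probability } 1-p .$$ Put $E=r_p\,M\circ C$, where $r_p=\sqrt{(1-p)/p}$ and $\circ$ is the entrywise (Hadamard) product. Write $\|\cdot\|_2$ for the spectral norm and $\|M\|_\infty=\max_{i,j}|M_{ij}|$, and let $m_E$ be any median of $\|E\|_2$. Then, for every $t\ge 0$, $$P\big(\big|\|E\|_2-m_E\big|>t\big)\le 4\exp\Big(-\frac{p^2}{8\|M\|_\infty^2}\,t^2\Big)$$ (for $M=0$ the exponent is not defined; this case is trivial, since then $E=0$ and $m_E=0$). Moreover, $\|E\|_2^2$ and $\|E\|_2^3$ are integrable, with $$\mathbf E\big[\|E\|_2^2\big]\le m_E^2+32\,\frac{\|M\|_\infty^2}{p^2}+8\,m_E\sqrt{\frac{2\pi\|M\|_\infty^2}{p^2}}$$ and $$\mathbf E\big[\|E\|_2^3\big]\le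 4\,m_E^3+12\sqrt{\pi}\,\Big(\frac{8\|M\|_\infty^2}{p^2}\Big)^{3/2}.$$ -/

import Mathlib

open MeasureTheory ProbabilityTheory

noncomputable section

namespace Subsampling

/-- The spectral norm `‖A‖₂` of a square real matrix: its operator norm for the Euclidean norm. -/
def specNorm {n : ℕ} (A : Matrix (Fin n) (Fin n) ℝ) : ℝ :=
  ‖Matrix.toEuclideanCLM (n := Fin n) (𝕜 := ℝ) A‖

/-- The entrywise maximum `‖A‖_∞ = max_{i,j} |A i j|` (equal to `0` for the empty matrix). -/
def maxNorm {n : ℕ} (A : Matrix (Fin n) (Fin n) ℝ) : ℝ :=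
  ⨆ ij : Fin n × Fin n, |A ij.1 ij.2|

/-- `C` is a symmetric random matrix whose entries on and below the diagonal are independent, each
taking the value `√((1-p)/p)` with probability `p` and `-√(p/(1-p))` with probability `1-p`. -/
structure IsSamplingMatrix {Ω : Type*} [MeasurableSpace Ω] (P : Measure Ω) {n : ℕ} (p : ℝ)
    (C : Ω → Matrix (Fin n) (Fin n) ℝ) : Prop where
  measurable_entry : ∀ i j, Measurable fun ω => C ω i j
  symm : ∀ᵐ ω ∂P, (C ω).IsSymm
  prob_high : ∀ i j, j ≤ i → P.real {ω | C ω i j = √((1 - p) / p)} = p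
  prob_low : ∀ i j, j ≤ i → P.real {ω | C ω i j = -√(p / (1 - p))} = 1 - p
  indep : iIndepFun
    (fun (ij : {ij : Fin n × Fin n // ij.2 ≤ ij.1}) (ω : Ω) => C ω ij.1.1 ij.1.2) P

/-- The error matrix `E = r_p M ∘ C`, with `r_p = √((1-p)/p)` and `∘` the entrywise product. -/
def errorMatrix {n : ℕ} (p : ℝ) (M C : Matrix (Fin n) (Fin n) ℝ) : Matrix (Fin n) (Fin n) ℝ :=
  √((1 - p) / p) • Matrix.hadamard M C

/-- `m` is a median of the real random variable `X`. -/
def IsMedian {Ω : Type*} [MeasurableSpace Ω] (P : Measure Ω) (X : Ω → ℝ) (m : ℝ) : Prop :=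
  1 / 2 ≤ P.real {ω | X ω ≤ m} ∧ 1 / 2 ≤ P.real {ω | m ≤ X ω}

end Subsampling

end

/-!
The spectral norm of `M ∘ C` is a convex function of the entries of `C` on and below the diagonal,
and it is `√2 ‖M‖_∞`-Lipschitz for the Euclidean distance because each such entry occurs at most
twice. Concentration of convex Lipschitz functions of independent bounded variables rests on
Talagrand's convex distance inequality `E exp (d(X, K)² / (4 σ²)) ≤ 1 / P(X ∈ K)` for compact convex
`K`, with `d` the Euclidean distance and each variable ranging in an interval of length `σ`. It goes
by induction on the number of variables. Given the first variable, convexity bounds the squared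
distance to `K` by a convex combination, with weights `θ` and `1 - θ`, of the squared distances to
the section of `K` and to the projection of `K`, plus `(1 - θ)² σ²`; Hölder's inequality and the
best `θ` close the induction. Markov's inequality on the sublevel sets of the norm then gives
Gaussian tails around a median, and integrating these tails gives the moments.
-/

namespace Subsampling

open scoped ENNReal NNReal

section ConvexDistance

/-- The squared Euclidean distance from `x` to the set `K`, with value `0` for empty `K`. It is kept
on `ι → ℝ`, instead of being the square of `Metric.infDist` on `EuclideanSpace ℝ ι`, so that
`Fin.cons` splits off one coordinate. -/
noncomputable def sqDist {ι : Type*} [Fintype ι] (K : Set (ι → ℝ)) (x : ι → ℝ) : ℝ :=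
  ⨅ y : K, ∑ i, (x i - y.1 i) ^ 2

/-- The exponential `exp (d(x, K)² / (4 σ²))` of the squared distance, whose mean is bounded in the
convex distance inequality. -/
noncomputable def expSqDist {ι : Type*} [Fintype ι] (σ : ℝ) (K : Set (ι → ℝ)) (x : ι → ℝ) : ℝ≥0∞ :=
  ENNReal.ofReal (Real.exp (sqDist K x / (4 * σ ^ 2)))

section

variable {ι : Type*} [Fintype ι] {K : Set (ι → ℝ)}

lemma bddBelow_range_sum_sq_sub (K : Set (ι → ℝ)) (x : ι → ℝ) :
    BddBelow (Set.range fun y : K => ∑ i, (x i - y.1 i) ^ 2) :=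
  ⟨0, Set.forall_mem_range.2 fun _ => Finset.sum_nonneg fun _ _ => sq_nonneg _⟩

lemma sqDist_le (x : ι → ℝ) {y : ι → ℝ} (hy : y ∈ K) : sqDist K x ≤ ∑ i, (x i - y i) ^ 2 :=
  ciInf_le (bddBelow_range_sum_sq_sub K x) ⟨y, hy⟩

lemma exists_sqDist_eq (hK : IsCompact K) (hne : K.Nonempty) (x : ι → ℝ) :
    ∃ y ∈ K, sqDist K x = ∑ i, (x i - y i) ^ 2 := by
  have hcont : Continuous fun y : ι → ℝ => ∑ i, (x i - y i) ^ 2 := by fun_prop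
  obtain ⟨y, hy, hmin⟩ := hK.exists_isMinOn hne hcont.continuousOn
  have : Nonempty K := hne.to_subtype
  exact ⟨y, hy, (sqDist_le x hy).antisymm (le_ciInf fun z => hmin z.2)⟩

lemma measurable_sqDist (K : Set (ι → ℝ)) : Measurable (sqDist K) := by
  refine (upperSemicontinuous_ciInf (bddBelow_range_sum_sq_sub K) fun y => ?_).measurable
  exact Continuous.upperSemicontinuous (by fun_prop)

lemma measurable_expSqDist (σ : ℝ) (K : Set (ι → ℝ)) : Measurable (expSqDist σ K) :=
  ((measurable_sqDist K).div_const _).exp.ennreal_ofReal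

end

section Fiber

variable {N : ℕ} {K : Set (Fin (N + 1) → ℝ)}

/-- The section of `K` over the value `ω` of its first coordinate. -/
def fiber (K : Set (Fin (N + 1) → ℝ)) (ω : ℝ) : Set (Fin N → ℝ) :=
  {y | (Fin.cons ω y : Fin (N + 1) → ℝ) ∈ K}

lemma fiber_subset_image_tail (K : Set (Fin (N + 1) → ℝ)) (ω : ℝ) : fiber K ω ⊆ Fin.tail '' K :=
  fun y hy => ⟨Fin.cons ω y, hy, Fin.tail_cons (α := fun _ => ℝ) ω y⟩

lemma convex_fiber (hK : Convex ℝ K) (ω : ℝ) : Convex ℝ (fiber K ω) := by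
  intro y hy z hz α β hα hβ hαβ
  have hcons : (Fin.cons ω (α • y + β • z) : Fin (N + 1) → ℝ)
      = α • (Fin.cons ω y : Fin (N + 1) → ℝ) + β • (Fin.cons ω z : Fin (N + 1) → ℝ) := by
    funext i
    refine Fin.cases ?_ (fun j => ?_) i
    · simp [← add_mul, hαβ]
    · simp
  simpa only [fiber, Set.mem_ofPred_eq, hcons] using hK hy hz hα hβ hαβ

lemma convex_image_tail (hK : Convex ℝ K) : Convex ℝ (Fin.tail '' K : Set (Fin N → ℝ)) :=
  hK.is_linear_image ⟨fun _ _ => rfl, fun _ _ => rfl⟩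

lemma continuous_tail : Continuous (Fin.tail : (Fin (N + 1) → ℝ) → Fin N → ℝ) := by
  unfold Fin.tail
  fun_prop

lemma isCompact_image_tail (hK : IsCompact K) : IsCompact (Fin.tail '' K : Set (Fin N → ℝ)) :=
  hK.image continuous_tail

lemma isCompact_fiber (hK : IsCompact K) (ω : ℝ) : IsCompact (fiber K ω) :=
  (isCompact_image_tail hK).of_isClosed_subset
    (hK.isClosed.preimage (continuous_const.finCons continuous_id))
    (fiber_subset_image_tail K ω)

lemma sqDist_cons_le_add_sq (hK : IsCompact K) (hne : K.Nonempty) {σ ω : ℝ}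
    (hσ : ∀ z ∈ K, (ω - z 0) ^ 2 ≤ σ ^ 2) (x : Fin N → ℝ) :
    sqDist K (Fin.cons ω x) ≤ σ ^ 2 + sqDist (Fin.tail '' K) x := by
  obtain ⟨_, ⟨z, hz, rfl⟩, hxz⟩ := exists_sqDist_eq (isCompact_image_tail hK) (hne.image _) x
  refine (sqDist_le _ hz).trans ?_
  rw [Fin.sum_univ_succ, hxz]
  exact add_le_add (hσ z hz) le_rfl

lemma sqDist_cons_le_convexCombo (hconv : Convex ℝ K) (hK : IsCompact K) {σ ω : ℝ}
    (hne : (fiber K ω).Nonempty) (hσ : ∀ z ∈ K, (ω - z 0) ^ 2 ≤ σ ^ 2) {θ : ℝ}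
    (hθ : θ ∈ Set.Icc 0 1) (x : Fin N → ℝ) :
    sqDist K (Fin.cons ω x)
      ≤ (1 - θ) ^ 2 * σ ^ 2 + (θ * sqDist (fiber K ω) x
        + (1 - θ) * sqDist (Fin.tail '' K) x) := by
  have hθ' : 0 ≤ 1 - θ := sub_nonneg.2 hθ.2
  obtain ⟨y, hy, hxy⟩ := exists_sqDist_eq (isCompact_fiber hK ω) hne x
  obtain ⟨_, ⟨z, hz, rfl⟩, hxz⟩ := exists_sqDist_eq (isCompact_image_tail hK)
    (hne.mono (fiber_subset_image_tail K ω)) x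
  refine (sqDist_le _ (hconv hy hz hθ.1 hθ' (add_sub_cancel θ 1))).trans ?_
  rw [Fin.sum_univ_succ, hxy, hxz, Finset.mul_sum, Finset.mul_sum, ← Finset.sum_add_distrib]
  refine add_le_add ?_ (Finset.sum_le_sum fun i _ => ?_)
  · have hfirst : ω - (θ * ω + (1 - θ) * z 0) = (1 - θ) * (ω - z 0) := by ring
    simp only [Fin.cons_zero, Pi.add_apply, Pi.smul_apply, smul_eq_mul, hfirst, mul_pow]
    exact mul_le_mul_of_nonneg_left (hσ z hz) (sq_nonneg _)
  · simp only [Fin.cons_succ, Pi.add_apply, Pi.smul_apply, smul_eq_mul, Fin.tail]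
    linarith [mul_nonneg (mul_nonneg hθ.1 hθ') (sq_nonneg (y i - z i.succ))]

lemma expSqDist_cons_le (hK : IsCompact K) (hne : K.Nonempty) {σ ω : ℝ} (hσ0 : σ ≠ 0)
    (hσ : ∀ z ∈ K, (ω - z 0) ^ 2 ≤ σ ^ 2) (x : Fin N → ℝ) :
    expSqDist σ K (Fin.cons ω x)
      ≤ ENNReal.ofReal (Real.exp (1 / 4)) * expSqDist σ (Fin.tail '' K) x := by
  rw [expSqDist, expSqDist, ← ENNReal.ofReal_mul (Real.exp_nonneg _), ← Real.exp_add]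
  gcongr
  rw [div_le_iff₀ (by positivity)]
  refine (sqDist_cons_le_add_sq hK hne hσ x).trans_eq ?_
  field_simp

lemma expSqDist_cons_le_geomMean (hconv : Convex ℝ K) (hK : IsCompact K) {σ ω : ℝ} (hσ0 : σ ≠ 0)
    (hne : (fiber K ω).Nonempty) (hσ : ∀ z ∈ K, (ω - z 0) ^ 2 ≤ σ ^ 2) {θ : ℝ}
    (hθ : θ ∈ Set.Icc 0 1) (x : Fin N → ℝ) :
    expSqDist σ K (Fin.cons ω x) ≤ ENNReal.ofReal (Real.exp ((1 - θ) ^ 2 / 4))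
      * (expSqDist σ (fiber K ω) x ^ θ * expSqDist σ (Fin.tail '' K) x ^ (1 - θ)) := by
  simp only [expSqDist, ENNReal.ofReal_rpow_of_pos (Real.exp_pos _), ← Real.exp_mul]
  rw [← ENNReal.ofReal_mul (Real.exp_nonneg _), ← Real.exp_add,
    ← ENNReal.ofReal_mul (Real.exp_nonneg _), ← Real.exp_add]
  gcongr
  rw [div_le_iff₀ (by positivity)]
  refine (sqDist_cons_le_convexCombo hconv hK hne hσ hθ x).trans_eq ?_
  field_simp

lemma lintegral_expSqDist_cons_le (hconv : Convex ℝ K) (hK : IsCompact K) {σ ω : ℝ}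
    (hσ0 : σ ≠ 0) (hne : (fiber K ω).Nonempty) (hσ : ∀ z ∈ K, (ω - z 0) ^ 2 ≤ σ ^ 2) {θ : ℝ}
    (hθ : θ ∈ Set.Icc 0 1) (ν : Measure (Fin N → ℝ)) :
    ∫⁻ x, expSqDist σ K (Fin.cons ω x) ∂ν ≤ ENNReal.ofReal (Real.exp ((1 - θ) ^ 2 / 4))
      * ((∫⁻ x, expSqDist σ (fiber K ω) x ∂ν) ^ θ
        * (∫⁻ x, expSqDist σ (Fin.tail '' K) x ∂ν) ^ (1 - θ)) := by
  refine (lintegral_mono (expSqDist_cons_le_geomMean hconv hK hσ0 hne hσ hθ)).trans ?_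
  have hmeas (L : Set (Fin N → ℝ)) : Measurable (expSqDist σ L) := measurable_expSqDist σ L
  rw [lintegral_const_mul _ (by fun_prop)]
  gcongr
  exact ENNReal.lintegral_mul_norm_pow_le (hmeas _).aemeasurable (hmeas _).aemeasurable hθ.1
    (sub_nonneg.2 hθ.2) (add_sub_cancel θ 1)

lemma exp_sub_sq_add_exp_neg_le_two {s : ℝ} (h0 : 0 ≤ s) (h1 : s ≤ 1 / 2) :
    Real.exp (s - s ^ 2) + Real.exp (-s) ≤ 2 := by
  have hcosh : Real.exp (s - s ^ 2) + Real.exp (-s)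
      = 2 * (Real.exp (-(s ^ 2 / 2)) * Real.cosh (s - s ^ 2 / 2)) := by
    rw [Real.cosh_eq, mul_div_assoc', mul_div_cancel₀ _ two_ne_zero, mul_add, ← Real.exp_add,
      ← Real.exp_add]
    ring_nf
  have hexp : Real.exp (-(s ^ 2 / 2)) * Real.cosh (s - s ^ 2 / 2) ≤ 1 :=
    calc Real.exp (-(s ^ 2 / 2)) * Real.cosh (s - s ^ 2 / 2)
        ≤ Real.exp (-(s ^ 2 / 2)) * Real.exp ((s - s ^ 2 / 2) ^ 2 / 2) := by
          gcongr
          exact Real.cosh_le_exp_half_sq _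
      _ ≤ 1 := by
          rw [← Real.exp_add, Real.exp_le_one_iff]
          nlinarith [pow_nonneg h0 3, mul_nonneg (pow_nonneg h0 3) (sub_nonneg.2 h1)]
  linarith

lemma exp_quarter_add_exp_neg_half_le_two : Real.exp (1 / 4) + Real.exp (-(1 / 2)) ≤ 2 := by
  convert exp_sub_sq_add_exp_neg_le_two (s := 1 / 2) (by norm_num) le_rfl using 3
  norm_num

lemma exists_exp_mul_rpow_neg_le_two_sub {r : ℝ} (h0 : 0 < r) (h1 : r ≤ 1) :
    ∃ θ ∈ Set.Icc (0 : ℝ) 1, Real.exp ((1 - θ) ^ 2 / 4) * r ^ (-θ) ≤ 2 - r := by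
  obtain ⟨s, rfl⟩ : ∃ s, Real.exp (-s) = r := ⟨-Real.log r, by rw [neg_neg, Real.exp_log h0]⟩
  have hs : 0 ≤ s := by simpa using h1
  simp only [← Real.exp_mul, ← Real.exp_add]
  -- The exponent `(1 - θ) ^ 2 / 4 + s θ` is minimal over `[0, 1]` at `θ = max (1 - 2 s) 0`.
  rcases le_total s (1 / 2) with h | h
  · refine ⟨1 - 2 * s, ⟨by linarith, by linarith⟩, ?_⟩
    convert le_sub_iff_add_le.2 (exp_sub_sq_add_exp_neg_le_two hs h) using 2
    ring
  · refine ⟨0, ⟨le_rfl, zero_le_one⟩, ?_⟩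
    have hexp : Real.exp (-s) ≤ Real.exp (-(1 / 2)) := by gcongr
    simp only [sub_zero, one_pow, neg_zero, mul_zero, add_zero]
    linarith [exp_quarter_add_exp_neg_half_le_two]

lemma exists_exp_mul_geomMean_inv_le {u v : ℝ} (hu : 0 < u) (huv : u ≤ v) :
    ∃ θ ∈ Set.Icc (0 : ℝ) 1,
      Real.exp ((1 - θ) ^ 2 / 4) * (u⁻¹ ^ θ * v⁻¹ ^ (1 - θ)) + u / v ^ 2 ≤ 2 / v := by
  have hv : 0 < v := hu.trans_le huv
  obtain ⟨θ, hθ, h⟩ := exists_exp_mul_rpow_neg_le_two_sub (div_pos hu hv) ((div_le_one hv).2 huv)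
  refine ⟨θ, hθ, ?_⟩
  have hmean : u⁻¹ ^ θ * v⁻¹ ^ (1 - θ) = (u / v) ^ (-θ) / v := by
    rw [Real.rpow_sub (by positivity), Real.rpow_one, Real.div_rpow hu.le hv.le,
      Real.inv_rpow hu.le, Real.inv_rpow hv.le, Real.rpow_neg hu.le, Real.rpow_neg hv.le]
    field_simp
  calc Real.exp ((1 - θ) ^ 2 / 4) * (u⁻¹ ^ θ * v⁻¹ ^ (1 - θ)) + u / v ^ 2
      = (Real.exp ((1 - θ) ^ 2 / 4) * (u / v) ^ (-θ)) / v + u / v / v := by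
        rw [hmean, mul_div_assoc, div_div u, ← sq v]
    _ ≤ (2 - u / v) / v + u / v / v := by gcongr
    _ = 2 / v := by rw [sub_div, sub_add_cancel]

lemma exists_ofReal_exp_mul_geomMean_inv_le {u v : ℝ≥0∞} (hu : u ≠ 0) (huv : u ≤ v) (hv : v ≠ ∞) :
    ∃ θ ∈ Set.Icc (0 : ℝ) 1,
      ENNReal.ofReal (Real.exp ((1 - θ) ^ 2 / 4)) * (u⁻¹ ^ θ * v⁻¹ ^ (1 - θ)) + u / v ^ 2
        ≤ 2 / v := by
  have hu' : 0 < u.toReal := ENNReal.toReal_pos hu (ne_top_of_le_ne_top hv huv)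
  have hv' : 0 < v.toReal := hu'.trans_le (ENNReal.toReal_mono hv huv)
  obtain ⟨θ, hθ, h⟩ := exists_exp_mul_geomMean_inv_le hu' (ENNReal.toReal_mono hv huv)
  refine ⟨θ, hθ, ?_⟩
  rw [← ENNReal.ofReal_toReal hv, ← ENNReal.ofReal_toReal (ne_top_of_le_ne_top hv huv),
    ← ENNReal.ofReal_inv_of_pos hu', ← ENNReal.ofReal_inv_of_pos hv',
    ENNReal.ofReal_rpow_of_pos (inv_pos.2 hu'), ENNReal.ofReal_rpow_of_pos (inv_pos.2 hv'),
    ← ENNReal.ofReal_pow hv'.le, ← ENNReal.ofReal_div_of_pos (pow_pos hv' 2),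
    ← ENNReal.ofReal_mul (by positivity), ← ENNReal.ofReal_mul (by positivity),
    ← ENNReal.ofReal_add (by positivity) (by positivity), ← ENNReal.ofReal_ofNat 2,
    ← ENNReal.ofReal_div_of_pos hv']
  exact ENNReal.ofReal_le_ofReal h

lemma le_inv_of_add_div_sq_le {g w v : ℝ≥0∞} (hv0 : v ≠ 0) (hv : v ≠ ∞)
    (h : g + w / v ^ 2 ≤ 2 / v) : g ≤ w⁻¹ := by
  have htwo : 2 / v ≠ ∞ := ENNReal.div_ne_top ENNReal.ofNat_ne_top hv0
  have hg : g ≠ ∞ := ne_top_of_le_ne_top htwo (le_self_add.trans h)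
  have hw : w ≠ ∞ := by
    rintro rfl
    rw [ENNReal.top_div_of_ne_top (ENNReal.pow_ne_top hv), add_top] at h
    exact htwo (top_le_iff.1 h)
  rcases eq_or_ne w 0 with rfl | hw0
  · simp
  have hv' : 0 < v.toReal := ENNReal.toReal_pos hv0 hv
  have hw' : 0 < w.toReal := ENNReal.toReal_pos hw0 hw
  have hreal : g.toReal + w.toReal / v.toReal ^ 2 ≤ 2 / v.toReal := by
    have := ENNReal.toReal_mono htwo h
    rwa [ENNReal.toReal_add hg (ENNReal.div_ne_top hw (pow_ne_zero 2 hv0)), ENNReal.toReal_div,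
      ENNReal.toReal_pow, ENNReal.toReal_div, ENNReal.toReal_ofNat] at this
  rw [← ENNReal.toReal_le_toReal hg (ENNReal.inv_ne_top.2 hw0), ENNReal.toReal_inv]
  have hsq : w.toReal⁻¹ - (2 / v.toReal - w.toReal / v.toReal ^ 2)
      = (v.toReal - w.toReal) ^ 2 / (w.toReal * v.toReal ^ 2) := by
    field_simp
    ring
  have : 0 ≤ (v.toReal - w.toReal) ^ 2 / (w.toReal * v.toReal ^ 2) := by positivity
  linarith

lemma lintegral_expSqDist_cons_add_le (hconv : Convex ℝ K) (hK : IsCompact K) (hne : K.Nonempty)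
    {σ ω : ℝ} (hσ0 : σ ≠ 0) (hσ : ∀ z ∈ K, (ω - z 0) ^ 2 ≤ σ ^ 2)
    (ν : Measure (Fin N → ℝ)) [IsFiniteMeasure ν]
    (hfiber : ∫⁻ x, expSqDist σ (fiber K ω) x ∂ν ≤ (ν (fiber K ω))⁻¹)
    (htail : ∫⁻ x, expSqDist σ (Fin.tail '' K) x ∂ν ≤ (ν (Fin.tail '' K))⁻¹) :
    ∫⁻ x, expSqDist σ K (Fin.cons ω x) ∂ν + ν (fiber K ω) / ν (Fin.tail '' K) ^ 2
      ≤ 2 / ν (Fin.tail '' K) := by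
  rcases eq_or_ne (ν (fiber K ω)) 0 with hzero | hpos
  · rw [hzero, ENNReal.zero_div, add_zero, div_eq_mul_inv]
    refine (lintegral_mono (expSqDist_cons_le hK hne hσ0 hσ)).trans ?_
    rw [lintegral_const_mul _ (measurable_expSqDist _ _)]
    gcongr
    rw [ENNReal.ofReal_le_ofNat]
    linarith [exp_quarter_add_exp_neg_half_le_two, Real.exp_pos (-(1 / 2))]
  · obtain ⟨θ, hθ, h⟩ := exists_ofReal_exp_mul_geomMean_inv_le hpos
      (measure_mono (fiber_subset_image_tail K ω)) (measure_ne_top ν (Fin.tail '' K))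
    refine (add_le_add_left ?_ _).trans h
    refine (lintegral_expSqDist_cons_le hconv hK hσ0 (nonempty_of_measure_ne_zero hpos) hσ hθ
      ν).trans ?_
    gcongr
    exacts [hθ.1, sub_nonneg.2 hθ.2]

lemma lintegral_pi_succ (μ : Fin (N + 1) → Measure ℝ) [∀ i, SigmaFinite (μ i)]
    {f : (Fin (N + 1) → ℝ) → ℝ≥0∞} (hf : Measurable f) :
    ∫⁻ x, f x ∂Measure.pi μ
      = ∫⁻ ω, ∫⁻ x, f (Fin.cons ω x) ∂Measure.pi (fun i => μ i.succ) ∂μ 0 := by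
  rw [← (measurePreserving_piFinSuccAbove μ 0).symm.lintegral_comp hf, lintegral_prod]
  · simp [MeasurableEquiv.piFinSuccAbove, Fin.consEquiv]
  · exact (hf.comp (MeasurableEquiv.measurable _)).aemeasurable

lemma pi_succ_eq_lintegral_fiber (μ : Fin (N + 1) → Measure ℝ) [∀ i, SigmaFinite (μ i)]
    (hK : MeasurableSet K) :
    Measure.pi μ K = ∫⁻ ω, Measure.pi (fun i => μ i.succ) (fiber K ω) ∂μ 0 := by
  have hfiber (ω : ℝ) : MeasurableSet (fiber K ω) :=
    hK.preimage (f := fun x : Fin N → ℝ => (Fin.cons ω x : Fin (N + 1) → ℝ)) (by fun_prop)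
  rw [← lintegral_indicator_one hK, lintegral_pi_succ μ (measurable_one.indicator hK)]
  exact lintegral_congr fun ω => lintegral_indicator_one (hfiber ω)

lemma lintegral_expSqDist_pi_succ_le (μ : Fin (N + 1) → Measure ℝ)
    [∀ i, IsProbabilityMeasure (μ i)] {σ : ℝ} (hσ0 : σ ≠ 0) (hconv : Convex ℝ K) (hK : IsCompact K)
    (hσ : ∀ᵐ ω ∂μ 0, ∀ z ∈ K, (ω - z 0) ^ 2 ≤ σ ^ 2)
    (ih : ∀ L : Set (Fin N → ℝ), Convex ℝ L → IsCompact L → L ⊆ Fin.tail '' K →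
      ∫⁻ x, expSqDist σ L x ∂Measure.pi (fun i => μ i.succ)
        ≤ (Measure.pi (fun i => μ i.succ) L)⁻¹) :
    ∫⁻ x, expSqDist σ K x ∂Measure.pi μ ≤ (Measure.pi μ K)⁻¹ := by
  set ν : Measure (Fin N → ℝ) := Measure.pi fun i => μ i.succ
  have hμK : Measure.pi μ K = ∫⁻ ω, ν (fiber K ω) ∂μ 0 :=
    pi_succ_eq_lintegral_fiber μ hK.measurableSet
  rcases eq_or_ne (ν (Fin.tail '' K)) 0 with hzero | hpos
  · have hfiber (ω : ℝ) : ν (fiber K ω) = 0 :=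
      measure_mono_null (fiber_subset_image_tail K ω) hzero
    simp only [hμK, hfiber, lintegral_zero, ENNReal.inv_zero, le_top]
  have hne : K.Nonempty := Set.image_nonempty.1 (nonempty_of_measure_ne_zero hpos)
  have hmeas : Measurable fun ω => ∫⁻ x, expSqDist σ K (Fin.cons ω x : Fin (N + 1) → ℝ) ∂ν :=
    ((measurable_expSqDist σ K).comp (by fun_prop : Measurable fun q : ℝ × (Fin N → ℝ) =>
      (Fin.cons q.1 q.2 : Fin (N + 1) → ℝ))).lintegral_prod_right'
  refine le_inv_of_add_div_sq_le hpos (measure_ne_top ν _) ?_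
  calc ∫⁻ x, expSqDist σ K x ∂Measure.pi μ + Measure.pi μ K / ν (Fin.tail '' K) ^ 2
      = ∫⁻ ω, (∫⁻ x, expSqDist σ K (Fin.cons ω x) ∂ν
          + ν (fiber K ω) / ν (Fin.tail '' K) ^ 2) ∂μ 0 := by
        rw [lintegral_add_left hmeas, lintegral_pi_succ μ (measurable_expSqDist σ K), hμK]
        simp only [div_eq_mul_inv]
        rw [lintegral_mul_const']
        exact ENNReal.inv_ne_top.2 (pow_ne_zero 2 hpos)
    _ ≤ ∫⁻ _, 2 / ν (Fin.tail '' K) ∂μ 0 := by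
        refine lintegral_mono_ae (hσ.mono fun ω hω => ?_)
        exact lintegral_expSqDist_cons_add_le hconv hK hne hσ0 hω ν
          (ih _ (convex_fiber hconv ω) (isCompact_fiber hK ω) (fiber_subset_image_tail K ω))
          (ih _ (convex_image_tail hconv) (isCompact_image_tail hK) subset_rfl)
    _ = 2 / ν (Fin.tail '' K) := by simp

end Fiber

theorem lintegral_expSqDist_pi_le {N : ℕ} (μ : Fin N → Measure ℝ) [∀ i, IsProbabilityMeasure (μ i)]
    {σ : ℝ} (hσ : 0 < σ) {a b : Fin N → ℝ} (hab : ∀ i, b i - a i ≤ σ)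
    (hμ : ∀ i, ∀ᵐ x ∂μ i, x ∈ Set.Icc (a i) (b i)) {K : Set (Fin N → ℝ)} (hconv : Convex ℝ K)
    (hK : IsCompact K) (hKab : K ⊆ Set.Icc a b) :
    ∫⁻ x, expSqDist σ K x ∂Measure.pi μ ≤ (Measure.pi μ K)⁻¹ := by
  induction N with
  | zero =>
    rcases K.eq_empty_or_nonempty with rfl | ⟨y, hy⟩
    · simp
    have hle (x : Fin 0 → ℝ) : expSqDist σ K x ≤ 1 := by
      rw [expSqDist, ENNReal.ofReal_le_one, Real.exp_le_one_iff]
      exact div_nonpos_of_nonpos_of_nonneg (by simpa using sqDist_le x hy) (by positivity)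
    calc ∫⁻ x, expSqDist σ K x ∂Measure.pi μ ≤ ∫⁻ _, 1 ∂Measure.pi μ := lintegral_mono hle
      _ = 1 := by simp
      _ ≤ (Measure.pi μ K)⁻¹ := ENNReal.one_le_inv.2 prob_le_one
  | succ N ih =>
    refine lintegral_expSqDist_pi_succ_le μ hσ.ne' hconv hK ?_ fun L hLconv hL hLK => ?_
    · filter_upwards [hμ 0] with ω hω z hz
      have hz' : z 0 ∈ Set.Icc (a 0) (b 0) := ⟨(hKab hz).1 0, (hKab hz).2 0⟩
      exact sq_le_sq' (by linarith [hab 0, hω.1, hz'.2]) (by linarith [hab 0, hω.2, hz'.1])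
    · refine ih (fun i => μ i.succ) (fun i => hab i.succ) (fun i => hμ i.succ) hLconv hL ?_
      rintro _ hy
      obtain ⟨z, hz, rfl⟩ := hLK hy
      exact ⟨fun i => (hKab hz).1 i.succ, fun i => (hKab hz).2 i.succ⟩

theorem pi_mul_pi_le_sqDist_le {N : ℕ} (μ : Fin N → Measure ℝ) [∀ i, IsProbabilityMeasure (μ i)]
    {σ : ℝ} (hσ : 0 < σ) {a b : Fin N → ℝ} (hab : ∀ i, b i - a i ≤ σ)
    (hμ : ∀ i, ∀ᵐ x ∂μ i, x ∈ Set.Icc (a i) (b i)) {K : Set (Fin N → ℝ)} (hconv : Convex ℝ K)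
    (hK : IsCompact K) (hKab : K ⊆ Set.Icc a b) (s : ℝ) :
    (Measure.pi μ).real K * (Measure.pi μ).real {x | s ≤ sqDist K x}
      ≤ Real.exp (-(s / (4 * σ ^ 2))) := by
  have hsub : {x | s ≤ sqDist K x}
      ⊆ {x | ENNReal.ofReal (Real.exp (s / (4 * σ ^ 2))) ≤ expSqDist σ K x} := fun x hx =>
    ENNReal.ofReal_le_ofReal (Real.exp_le_exp.2 (div_le_div_of_nonneg_right hx (by positivity)))
  have hmarkov : ENNReal.ofReal (Real.exp (s / (4 * σ ^ 2))) * Measure.pi μ {x | s ≤ sqDist K x}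
      ≤ (Measure.pi μ K)⁻¹ :=
    calc ENNReal.ofReal (Real.exp (s / (4 * σ ^ 2))) * Measure.pi μ {x | s ≤ sqDist K x}
        ≤ ENNReal.ofReal (Real.exp (s / (4 * σ ^ 2))) * Measure.pi μ
            {x | ENNReal.ofReal (Real.exp (s / (4 * σ ^ 2))) ≤ expSqDist σ K x} := by gcongr
      _ ≤ ∫⁻ x, expSqDist σ K x ∂Measure.pi μ :=
          mul_meas_ge_le_lintegral (measurable_expSqDist σ K) _
      _ ≤ (Measure.pi μ K)⁻¹ := lintegral_expSqDist_pi_le μ hσ hab hμ hconv hK hKab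
  rcases eq_or_ne (Measure.pi μ K) 0 with hzero | hpos
  · simp only [Measure.real, hzero, ENNReal.toReal_zero, zero_mul, Real.exp_nonneg]
  have hreal := ENNReal.toReal_mono (ENNReal.inv_ne_top.2 hpos) hmarkov
  rw [ENNReal.toReal_mul, ENNReal.toReal_ofReal (Real.exp_nonneg _), ENNReal.toReal_inv] at hreal
  have hK0 : (Measure.pi μ).real K ≠ 0 := (ENNReal.toReal_pos hpos (measure_ne_top _ _)).ne'
  calc (Measure.pi μ).real K * (Measure.pi μ).real {x | s ≤ sqDist K x}
      = Real.exp (-(s / (4 * σ ^ 2))) * ((Measure.pi μ).real K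
          * (Real.exp (s / (4 * σ ^ 2)) * (Measure.pi μ).real {x | s ≤ sqDist K x})) := by
        rw [Real.exp_neg]
        field_simp
    _ ≤ Real.exp (-(s / (4 * σ ^ 2))) * ((Measure.pi μ).real K * ((Measure.pi μ).real K)⁻¹) := by
        gcongr
        exact hreal
    _ = Real.exp (-(s / (4 * σ ^ 2))) := by rw [mul_inv_cancel₀ hK0, mul_one]

end ConvexDistance

section Concentration

lemma sq_div_sq_le_sqDist_of_lipschitzWith {ι : Type*} [Fintype ι] {F : EuclideanSpace ℝ ι → ℝ}
    {L : ℝ≥0} (hF : LipschitzWith L F) {K : Set (ι → ℝ)} (hK : IsCompact K) (hne : K.Nonempty)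
    {c t : ℝ} (hKc : ∀ y ∈ K, F (WithLp.toLp 2 y) ≤ c) (ht : 0 ≤ t) {x : ι → ℝ}
    (hx : c + t ≤ F (WithLp.toLp 2 x)) : t ^ 2 / L ^ 2 ≤ sqDist K x := by
  obtain ⟨y, hy, hxy⟩ := exists_sqDist_eq hK hne x
  have hdist : t ≤ L * dist (WithLp.toLp 2 x) (WithLp.toLp 2 y) := by
    have := (le_abs_self _).trans (hF.dist_le_mul (WithLp.toLp 2 x) (WithLp.toLp 2 y))
    linarith [hKc y hy]
  refine div_le_of_le_mul₀ (by positivity) (hxy ▸ by positivity) ?_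
  calc t ^ 2 ≤ (L * dist (WithLp.toLp 2 x) (WithLp.toLp 2 y)) ^ 2 := by gcongr
    _ = sqDist K x * L ^ 2 := by
      rw [hxy, mul_pow, mul_comm, EuclideanSpace.dist_eq, Real.sq_sqrt (by positivity)]
      simp only [Real.dist_eq, sq_abs]

theorem pi_le_mul_pi_ge_le_exp {N : ℕ} (μ : Fin N → Measure ℝ) [∀ i, IsProbabilityMeasure (μ i)]
    {σ : ℝ} (hσ : 0 < σ) {a b : Fin N → ℝ} (hab : ∀ i, b i - a i ≤ σ)
    (hμ : ∀ i, ∀ᵐ x ∂μ i, x ∈ Set.Icc (a i) (b i)) {F : EuclideanSpace ℝ (Fin N) → ℝ}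
    (hconv : ConvexOn ℝ Set.univ F) {L : ℝ≥0} (hF : LipschitzWith L F) (c : ℝ) {t : ℝ}
    (ht : 0 ≤ t) :
    (Measure.pi μ).real {x | F (WithLp.toLp 2 x) ≤ c}
        * (Measure.pi μ).real {x | c + t ≤ F (WithLp.toLp 2 x)}
      ≤ Real.exp (-(t ^ 2 / (4 * L ^ 2 * σ ^ 2))) := by
  set K : Set (Fin N → ℝ) := Set.Icc a b ∩ {x | F (WithLp.toLp 2 x) ≤ c}
  have hFcont : Continuous fun x : Fin N → ℝ => F (WithLp.toLp 2 x) :=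
    hF.continuous.comp (PiLp.continuous_toLp 2 _)
  have hK : IsCompact K := isCompact_Icc.inter_right (isClosed_le hFcont continuous_const)
  have hKconv : Convex ℝ K := (convex_Icc a b).inter (by
    simpa using (hconv.comp_linearMap
      (WithLp.linearEquiv 2 ℝ (Fin N → ℝ)).symm.toLinearMap).convex_le c)
  have hle : (Measure.pi μ).real {x | F (WithLp.toLp 2 x) ≤ c} ≤ (Measure.pi μ).real K := by
    refine ENNReal.toReal_mono (measure_ne_top _ _) (measure_mono_ae ?_)
    have hbox : ∀ᵐ x ∂Measure.pi μ, ∀ i, x i ∈ Set.Icc (a i) (b i) :=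
      ae_all_iff.2 fun i => Measure.tendsto_eval_ae_ae.eventually (hμ i)
    filter_upwards [hbox] with x hx hxc
    exact ⟨⟨fun i => (hx i).1, fun i => (hx i).2⟩, hxc⟩
  rcases K.eq_empty_or_nonempty with hempty | hne
  · rw [hempty, measureReal_empty] at hle
    rw [hle.antisymm measureReal_nonneg, zero_mul]
    exact Real.exp_nonneg _
  have hge : {x | c + t ≤ F (WithLp.toLp 2 x)} ⊆ {x | t ^ 2 / L ^ 2 ≤ sqDist K x} := fun x hx =>
    sq_div_sq_le_sqDist_of_lipschitzWith hF hK hne (fun y hy => hy.2) ht hx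
  calc (Measure.pi μ).real {x | F (WithLp.toLp 2 x) ≤ c}
        * (Measure.pi μ).real {x | c + t ≤ F (WithLp.toLp 2 x)}
      ≤ (Measure.pi μ).real K * (Measure.pi μ).real {x | t ^ 2 / L ^ 2 ≤ sqDist K x} :=
        mul_le_mul hle (measureReal_mono hge) measureReal_nonneg measureReal_nonneg
    _ ≤ Real.exp (-(t ^ 2 / L ^ 2 / (4 * σ ^ 2))) :=
        pi_mul_pi_le_sqDist_le μ hσ hab hμ hKconv hK Set.inter_subset_left _
    _ = Real.exp (-(t ^ 2 / (4 * L ^ 2 * σ ^ 2))) := by ring_nf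

variable {Ω : Type*} [MeasurableSpace Ω] {P : Measure Ω} [IsProbabilityMeasure P]

lemma measureReal_le_mul_measureReal_ge_le_exp_fin {N : ℕ} {X : Fin N → Ω → ℝ}
    (hX : ∀ i, AEMeasurable (X i) P) (hindep : iIndepFun X P) {σ : ℝ} (hσ : 0 < σ)
    {a b : Fin N → ℝ} (hab : ∀ i, b i - a i ≤ σ)
    (hbdd : ∀ i, ∀ᵐ ω ∂P, X i ω ∈ Set.Icc (a i) (b i)) {F : EuclideanSpace ℝ (Fin N) → ℝ}
    (hconv : ConvexOn ℝ Set.univ F) {L : ℝ≥0} (hF : LipschitzWith L F) (c : ℝ) {t : ℝ}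
    (ht : 0 ≤ t) :
    P.real {ω | F (WithLp.toLp 2 fun i => X i ω) ≤ c}
        * P.real {ω | c + t ≤ F (WithLp.toLp 2 fun i => X i ω)}
      ≤ Real.exp (-(t ^ 2 / (4 * L ^ 2 * σ ^ 2))) := by
  have hprob (i : Fin N) : IsProbabilityMeasure (P.map (X i)) :=
    Measure.isProbabilityMeasure_map (hX i)
  have hXm : AEMeasurable (fun ω i => X i ω) P := aemeasurable_pi_lambda _ hX
  have hFm : Measurable fun x : Fin N → ℝ => F (WithLp.toLp 2 x) :=
    (hF.continuous.comp (PiLp.continuous_toLp 2 _)).measurable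
  have hpi := pi_le_mul_pi_ge_le_exp (fun i => P.map (X i)) hσ hab
    (fun i => (ae_map_iff (hX i) measurableSet_Icc).2 (hbdd i)) hconv hF c ht
  rwa [← (iIndepFun_iff_map_fun_eq_pi_map hX).1 hindep,
    map_measureReal_apply_of_aemeasurable hXm (measurableSet_le hFm measurable_const),
    map_measureReal_apply_of_aemeasurable hXm (measurableSet_le measurable_const hFm)] at hpi

theorem measureReal_le_mul_measureReal_ge_le_exp {ι : Type*} [Fintype ι] {X : ι → Ω → ℝ}
    (hX : ∀ i, AEMeasurable (X i) P) (hindep : iIndepFun X P) {σ : ℝ} (hσ : 0 < σ)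
    {a b : ι → ℝ} (hab : ∀ i, b i - a i ≤ σ)
    (hbdd : ∀ i, ∀ᵐ ω ∂P, X i ω ∈ Set.Icc (a i) (b i)) {F : EuclideanSpace ℝ ι → ℝ}
    (hconv : ConvexOn ℝ Set.univ F) {L : ℝ≥0} (hF : LipschitzWith L F) (c : ℝ) {t : ℝ}
    (ht : 0 ≤ t) :
    P.real {ω | F (WithLp.toLp 2 fun i => X i ω) ≤ c}
        * P.real {ω | c + t ≤ F (WithLp.toLp 2 fun i => X i ω)}
      ≤ Real.exp (-(t ^ 2 / (4 * L ^ 2 * σ ^ 2))) := by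
  let e := Fintype.equivFin ι
  let φ := LinearIsometryEquiv.piLpCongrLeft 2 ℝ ℝ e.symm
  have hφ (ω : Ω) : φ (WithLp.toLp 2 fun k => X (e.symm k) ω) = WithLp.toLp 2 fun i => X i ω := by
    ext i
    simp [φ]
  have hφconv : ConvexOn ℝ Set.univ (F ∘ φ) := hconv.comp_linearMap φ.toLinearEquiv.toLinearMap
  have hφF : LipschitzWith L (F ∘ φ) := by simpa using hF.comp φ.lipschitz
  simpa only [Function.comp_apply, hφ] using measureReal_le_mul_measureReal_ge_le_exp_fin
    (fun k => hX (e.symm k)) (hindep.precomp e.symm.injective) hσ (fun k => hab (e.symm k))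
    (fun k => hbdd (e.symm k)) hφconv hφF c ht

end Concentration

section Moments

variable {Ω : Type*} [MeasurableSpace Ω] {P : Measure Ω}

lemma IsMedian.nonneg {Y : Ω → ℝ} {m : ℝ} (hm : IsMedian P Y m) (hY : ∀ ω, 0 ≤ Y ω) : 0 ≤ m := by
  by_contra! hneg
  have hempty : {ω | Y ω ≤ m} = ∅ := Set.eq_empty_of_forall_notMem fun ω hω =>
    (hneg.trans_le (hY ω)).not_ge hω
  have := hm.1
  rw [hempty, measureReal_empty] at this
  norm_num at this

lemma IsMedian.measureReal_lt_abs_sub_le [IsFiniteMeasure P] {Y : Ω → ℝ} {m : ℝ}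
    (hm : IsMedian P Y m) {t δ : ℝ} (h : ∀ c, P.real {ω | Y ω ≤ c} * P.real {ω | c + t ≤ Y ω} ≤ δ) :
    P.real {ω | t < |Y ω - m|} ≤ 4 * δ := by
  have hupper : P.real {ω | m + t ≤ Y ω} ≤ 2 * δ := by
    nlinarith [h m, hm.1, measureReal_nonneg (μ := P) (s := {ω | m + t ≤ Y ω})]
  have hlower : P.real {ω | Y ω ≤ m - t} ≤ 2 * δ := by
    have := h (m - t)
    rw [sub_add_cancel] at this
    nlinarith [hm.2, measureReal_nonneg (μ := P) (s := {ω | Y ω ≤ m - t})]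
  have hsub : {ω | t < |Y ω - m|} ⊆ {ω | m + t ≤ Y ω} ∪ {ω | Y ω ≤ m - t} :=
    fun ω (hω : t < |Y ω - m|) => (lt_abs.1 hω).imp
      (fun hlt => (lt_sub_iff_add_lt'.1 hlt).le) fun hlt => (by linarith : Y ω ≤ m - t)
  calc P.real {ω | t < |Y ω - m|} ≤ P.real ({ω | m + t ≤ Y ω} ∪ {ω | Y ω ≤ m - t}) :=
        measureReal_mono hsub
    _ ≤ P.real {ω | m + t ≤ Y ω} + P.real {ω | Y ω ≤ m - t} := measureReal_union_le _ _
    _ ≤ 4 * δ := by linarith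

lemma lintegral_rpow_le_of_gaussian_tail [IsFiniteMeasure P] {Y : Ω → ℝ} (hY : AEMeasurable Y P)
    (h0 : ∀ ω, 0 ≤ Y ω) {A c : ℝ} (hc : 0 < c)
    (htail : ∀ t : ℝ, 0 ≤ t → P.real {ω | t < Y ω} ≤ A * Real.exp (-c⁻¹ * t ^ 2)) {q : ℝ}
    (hq : 0 < q) :
    ∫⁻ ω, ENNReal.ofReal (Y ω ^ q) ∂P
      ≤ ENNReal.ofReal (q * (A * (c ^ (q / 2) * (1 / 2) * Real.Gamma (q / 2)))) := by
  have hint : ∫ t in Set.Ioi (0 : ℝ), t ^ (q - 1) * Real.exp (-c⁻¹ * t ^ (2 : ℝ))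
      = c ^ (q / 2) * (1 / 2) * Real.Gamma (q / 2) := by
    rw [integral_rpow_mul_exp_neg_mul_rpow two_pos (by linarith) (inv_pos.2 hc), sub_add_cancel,
      Real.inv_rpow hc.le, ← Real.rpow_neg hc.le, neg_div, neg_neg]
  have hintegrable : IntegrableOn (fun t : ℝ => t ^ (q - 1) * Real.exp (-c⁻¹ * t ^ (2 : ℝ)))
      (Set.Ioi 0) :=
    integrableOn_rpow_mul_exp_neg_mul_rpow (by linarith) two_pos (inv_pos.2 hc)
  have hA : 0 ≤ A := by simpa using measureReal_nonneg.trans (htail 0 le_rfl)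
  rw [lintegral_rpow_eq_lintegral_meas_lt_mul P (ae_of_all _ h0) hY hq, ENNReal.ofReal_mul hq.le,
    ← hint, ← integral_const_mul, ofReal_integral_eq_lintegral_ofReal (hintegrable.const_mul A)]
  · gcongr ENNReal.ofReal q * ?_
    refine setLIntegral_mono' measurableSet_Ioi fun t ht => ?_
    rw [← ofReal_measureReal, ← ENNReal.ofReal_mul measureReal_nonneg, mul_comm (t ^ (q - 1)),
      ← mul_assoc, Real.rpow_two]
    gcongr
    · exact Real.rpow_nonneg ht.le _
    · exact htail t ht.le
  · filter_upwards [ae_restrict_mem measurableSet_Ioi] with t ht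
    exact mul_nonneg hA (mul_nonneg (Real.rpow_nonneg ht.le _) (Real.exp_nonneg _))

lemma integral_rpow_le_of_gaussian_tail [IsFiniteMeasure P] {Y : Ω → ℝ} (hY : AEMeasurable Y P)
    (h0 : ∀ ω, 0 ≤ Y ω) {A c : ℝ} (hc : 0 < c)
    (htail : ∀ t : ℝ, 0 ≤ t → P.real {ω | t < Y ω} ≤ A * Real.exp (-c⁻¹ * t ^ 2)) {q : ℝ}
    (hq : 0 < q) :
    Integrable (fun ω => Y ω ^ q) P ∧
      ∫ ω, Y ω ^ q ∂P ≤ q * (A * (c ^ (q / 2) * (1 / 2) * Real.Gamma (q / 2))) := by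
  have hA : 0 ≤ A := by simpa using measureReal_nonneg.trans (htail 0 le_rfl)
  have : 0 ≤ Real.Gamma (q / 2) := (Real.Gamma_pos_of_pos (by positivity)).le
  have hnonneg : 0 ≤ᵐ[P] fun ω => Y ω ^ q := ae_of_all _ fun ω => Real.rpow_nonneg (h0 ω) q
  have hmeas : AEStronglyMeasurable (fun ω => Y ω ^ q) P := (hY.pow_const q).aestronglyMeasurable
  have hle := lintegral_rpow_le_of_gaussian_tail hY h0 hc htail hq
  refine ⟨⟨hmeas, ?_⟩, ?_⟩
  · rw [hasFiniteIntegral_iff_ofReal hnonneg]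
    exact hle.trans_lt ENNReal.ofReal_lt_top
  · rw [integral_eq_lintegral_of_nonneg_ae hnonneg hmeas]
    exact ENNReal.toReal_le_of_le_ofReal (by positivity) hle

variable [IsProbabilityMeasure P] {X : Ω → ℝ} {m A c : ℝ}

lemma integral_sq_le_of_gaussian_tail_abs_sub (hX : AEMeasurable X P) (hm : 0 ≤ m) (hc : 0 < c)
    (htail : ∀ t : ℝ, 0 ≤ t → P.real {ω | t < |X ω - m|} ≤ A * Real.exp (-c⁻¹ * t ^ 2)) :
    Integrable (fun ω => X ω ^ 2) P ∧
      ∫ ω, X ω ^ 2 ∂P ≤ m ^ 2 + A * c + A * m * √(Real.pi * c) := by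
  have hY : AEMeasurable (fun ω => |X ω - m|) P := (hX.sub_const m).abs
  obtain ⟨hint₁, hle₁⟩ := integral_rpow_le_of_gaussian_tail hY (fun _ => abs_nonneg _) hc htail
    one_pos
  obtain ⟨hint₂, hle₂⟩ := integral_rpow_le_of_gaussian_tail hY (fun _ => abs_nonneg _) hc htail
    two_pos
  simp only [Real.rpow_one, Real.rpow_two, ← Real.sqrt_eq_rpow, Real.Gamma_one_half_eq, ne_eq,
    OfNat.ofNat_ne_zero, not_false_eq_true, div_self, Real.Gamma_one] at hint₁ hle₁ hint₂ hle₂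
  have hint : Integrable (fun ω => m ^ 2 + 2 * m * |X ω - m|) P :=
    (integrable_const _).add (hint₁.const_mul _)
  have hbound (ω : Ω) : X ω ^ 2 ≤ m ^ 2 + 2 * m * |X ω - m| + |X ω - m| ^ 2 := by
    rw [sq_abs]
    nlinarith [le_abs_self (X ω - m)]
  refine ⟨(hint.add hint₂).mono' (hX.pow_const 2).aestronglyMeasurable
    (ae_of_all _ fun ω => by simpa using hbound ω), ?_⟩
  calc ∫ ω, X ω ^ 2 ∂P ≤ ∫ ω, (m ^ 2 + 2 * m * |X ω - m| + |X ω - m| ^ 2) ∂P :=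
        integral_mono_of_nonneg (ae_of_all _ fun ω => sq_nonneg _) (hint.add hint₂)
          (ae_of_all _ hbound)
    _ = m ^ 2 + 2 * m * ∫ ω, |X ω - m| ∂P + ∫ ω, |X ω - m| ^ 2 ∂P := by
        rw [integral_add hint hint₂, integral_add (integrable_const _) (hint₁.const_mul _),
          integral_const_mul]
        simp
    _ ≤ m ^ 2 + 2 * m * (1 * (A * (√c * (1 / 2) * √Real.pi))) + 2 * (A * (c * (1 / 2) * 1)) := by
        gcongr
    _ = m ^ 2 + A * c + A * m * √(Real.pi * c) := by
        rw [Real.sqrt_mul Real.pi_pos.le]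
        ring

lemma integral_pow_three_le_of_gaussian_tail_abs_sub (hX : AEMeasurable X P) (hX0 : ∀ ω, 0 ≤ X ω)
    (hm : 0 ≤ m) (hc : 0 < c)
    (htail : ∀ t : ℝ, 0 ≤ t → P.real {ω | t < |X ω - m|} ≤ A * Real.exp (-c⁻¹ * t ^ 2)) :
    Integrable (fun ω => X ω ^ 3) P ∧
      ∫ ω, X ω ^ 3 ∂P ≤ 4 * m ^ 3 + 3 * A * √Real.pi * c ^ (3 / 2 : ℝ) := by
  have hΓ : Real.Gamma (3 / 2) = √Real.pi / 2 := by
    rw [show (3 / 2 : ℝ) = 1 / 2 + 1 by norm_num, Real.Gamma_add_one (by norm_num),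
      Real.Gamma_one_half_eq]
    ring
  obtain ⟨hint, hle⟩ := integral_rpow_le_of_gaussian_tail (hX.sub_const m).abs
    (fun _ => abs_nonneg _) hc htail three_pos
  simp only [Real.rpow_ofNat, hΓ] at hint hle
  have hdom : Integrable (fun ω => 4 * m ^ 3 + 4 * |X ω - m| ^ 3) P :=
    (integrable_const _).add (hint.const_mul _)
  have hbound (ω : Ω) : X ω ^ 3 ≤ 4 * m ^ 3 + 4 * |X ω - m| ^ 3 :=
    calc X ω ^ 3 ≤ (m + |X ω - m|) ^ 3 := by
          gcongr
          · exact hX0 ω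
          · linarith [le_abs_self (X ω - m)]
      _ ≤ 4 * m ^ 3 + 4 * |X ω - m| ^ 3 := by
          refine (add_pow_le hm (abs_nonneg (X ω - m)) 3).trans_eq ?_
          ring
  refine ⟨hdom.mono' (hX.pow_const 3).aestronglyMeasurable (ae_of_all _ fun ω => ?_), ?_⟩
  · rw [Real.norm_of_nonneg (pow_nonneg (hX0 ω) 3)]
    exact hbound ω
  calc ∫ ω, X ω ^ 3 ∂P ≤ ∫ ω, (4 * m ^ 3 + 4 * |X ω - m| ^ 3) ∂P :=
        integral_mono_of_nonneg (ae_of_all _ fun ω => pow_nonneg (hX0 ω) 3) hdom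
          (ae_of_all _ hbound)
    _ = 4 * m ^ 3 + 4 * ∫ ω, |X ω - m| ^ 3 ∂P := by
        rw [integral_add (integrable_const _) (hint.const_mul _),
          integral_const_mul 4 fun ω => |X ω - m| ^ 3]
        simp
    _ ≤ 4 * m ^ 3 + 4 * (3 * (A * (c ^ (3 / 2 : ℝ) * (1 / 2) * (√Real.pi / 2)))) := by gcongr
    _ = 4 * m ^ 3 + 3 * A * √Real.pi * c ^ (3 / 2 : ℝ) := by ring

end Moments

section SpectralNorm

variable {n : ℕ}

lemma specNorm_nonneg (A : Matrix (Fin n) (Fin n) ℝ) : 0 ≤ specNorm A := norm_nonneg _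

lemma specNorm_le_sqrt_sum_sq (A : Matrix (Fin n) (Fin n) ℝ) :
    specNorm A ≤ √(∑ ij : Fin n × Fin n, A ij.1 ij.2 ^ 2) := by
  refine ContinuousLinearMap.opNorm_le_bound _ (Real.sqrt_nonneg _) fun x => ?_
  rw [EuclideanSpace.norm_eq, EuclideanSpace.norm_eq, ← Real.sqrt_mul (by positivity)]
  refine Real.sqrt_le_sqrt ?_
  rw [Fintype.sum_prod_type, Finset.sum_mul]
  refine Finset.sum_le_sum fun i _ => ?_
  simp only [Real.norm_eq_abs, sq_abs, Matrix.ofLp_toEuclideanCLM]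
  exact Finset.sum_mul_sq_le_sq_mul_sq Finset.univ (A i) x

/-- The index of an entry on or below the diagonal. -/
abbrev LowerIndex (n : ℕ) := {ij : Fin n × Fin n // ij.2 ≤ ij.1}

/-- The lower triangular index carrying the same entry of a symmetric matrix. -/
def lowerIndex (ij : Fin n × Fin n) : LowerIndex n :=
  ⟨(max ij.1 ij.2, min ij.1 ij.2), min_le_max⟩

lemma sum_comp_lowerIndex_le (f : LowerIndex n → ℝ) (hf : ∀ k, 0 ≤ f k) :
    ∑ ij, f (lowerIndex ij) ≤ 2 * ∑ k, f k := by
  have hcard (k : LowerIndex n) : (Finset.univ.filter fun ij => lowerIndex ij = k).card ≤ 2 := by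
    have hsub : (Finset.univ.filter fun ij => lowerIndex ij = k) ⊆ {k.1, k.1.swap} := by
      rintro ⟨i, j⟩ hij
      obtain rfl := (Finset.mem_filter.1 hij).2
      rcases le_total i j with h | h <;> simp [lowerIndex, h]
    exact (Finset.card_le_card hsub).trans Finset.card_le_two
  rw [← Finset.sum_fiberwise Finset.univ lowerIndex, Finset.mul_sum]
  refine Finset.sum_le_sum fun k _ => ?_
  rw [Finset.sum_congr rfl fun ij hij => by rw [(Finset.mem_filter.1 hij).2], Finset.sum_const,
    nsmul_eq_mul]
  exact mul_le_mul_of_nonneg_right (mod_cast hcard k) (hf k)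

/-- The linear map `x ↦ M ∘ S`, with `S` the symmetric matrix whose entries on and below the
diagonal are `x`. These entries form a Euclidean vector, so that concentration of convex Lipschitz
functions applies to the norm of the image. -/
def hadamardSymm (M : Matrix (Fin n) (Fin n) ℝ) :
    EuclideanSpace ℝ (LowerIndex n) →ₗ[ℝ] Matrix (Fin n) (Fin n) ℝ where
  toFun x := M.hadamard (Matrix.of fun i j => x (lowerIndex (i, j)))
  map_add' _ _ := Matrix.hadamard_add ..
  map_smul' _ _ := Matrix.hadamard_smul ..

lemma hadamardSymm_apply (M : Matrix (Fin n) (Fin n) ℝ) (x : EuclideanSpace ℝ (LowerIndex n))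
    (i j : Fin n) : hadamardSymm M x i j = M i j * x (lowerIndex (i, j)) := rfl

lemma hadamardSymm_lower (M : Matrix (Fin n) (Fin n) ℝ) {S : Matrix (Fin n) (Fin n) ℝ}
    (hS : S.IsSymm) :
    hadamardSymm M (WithLp.toLp 2 fun k : LowerIndex n => S k.1.1 k.1.2) = M.hadamard S := by
  ext i j
  rcases le_total i j with h | h
  · simp [hadamardSymm_apply, lowerIndex, h, hS.apply i j]
  · simp [hadamardSymm_apply, lowerIndex, h]

lemma convexOn_specNorm_hadamardSymm (M : Matrix (Fin n) (Fin n) ℝ) :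
    ConvexOn ℝ Set.univ fun x => specNorm (hadamardSymm M x) :=
  convexOn_univ_norm.comp_linearMap
    (LinearMapClass.linearMap (Matrix.toEuclideanCLM (n := Fin n) (𝕜 := ℝ)) ∘ₗ hadamardSymm M)

lemma continuous_specNorm_hadamardSymm (M : Matrix (Fin n) (Fin n) ℝ) :
    Continuous fun x => specNorm (hadamardSymm M x) :=
  ((LinearMapClass.linearMap (Matrix.toEuclideanCLM (n := Fin n) (𝕜 := ℝ))
    ∘ₗ hadamardSymm M).continuous_of_finiteDimensional).norm

variable {M : Matrix (Fin n) (Fin n) ℝ} {b : ℝ≥0}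

lemma specNorm_hadamardSymm_le (hM : ∀ i j, |M i j| ≤ b) (x : EuclideanSpace ℝ (LowerIndex n)) :
    specNorm (hadamardSymm M x) ≤ √2 * b * ‖x‖ := by
  have hentry (ij : Fin n × Fin n) :
      hadamardSymm M x ij.1 ij.2 ^ 2 ≤ b ^ 2 * x (lowerIndex ij) ^ 2 := by
    have hsq : M ij.1 ij.2 ^ 2 ≤ b ^ 2 := sq_le_sq.2 ((hM _ _).trans (le_abs_self _))
    rw [hadamardSymm_apply, mul_pow]
    exact mul_le_mul_of_nonneg_right hsq (sq_nonneg _)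
  refine (specNorm_le_sqrt_sum_sq _).trans (Real.sqrt_le_iff.2 ⟨by positivity, ?_⟩)
  calc ∑ ij : Fin n × Fin n, hadamardSymm M x ij.1 ij.2 ^ 2
      ≤ b ^ 2 * ∑ ij, x (lowerIndex ij) ^ 2 := by
        rw [Finset.mul_sum]
        exact Finset.sum_le_sum fun ij _ => hentry ij
    _ ≤ b ^ 2 * (2 * ∑ k, x k ^ 2) := by
        gcongr
        exact sum_comp_lowerIndex_le (fun k => x k ^ 2) fun k => sq_nonneg (x k)
    _ = (√2 * b * ‖x‖) ^ 2 := by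
        rw [mul_pow, mul_pow, Real.sq_sqrt zero_le_two, EuclideanSpace.real_norm_sq_eq]
        ring

lemma lipschitzWith_specNorm_hadamardSymm (hM : ∀ i j, |M i j| ≤ b) :
    LipschitzWith (NNReal.sqrt 2 * b) fun x => specNorm (hadamardSymm M x) := by
  refine LipschitzWith.of_dist_le_mul fun x y => ?_
  calc dist (specNorm (hadamardSymm M x)) (specNorm (hadamardSymm M y))
      ≤ specNorm (hadamardSymm M (x - y)) := by
        simpa only [specNorm, map_sub, Real.dist_eq] using abs_norm_sub_norm_le _ _
    _ ≤ ↑(NNReal.sqrt 2 * b) * dist x y := by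
        simpa [dist_eq_norm] using specNorm_hadamardSymm_le hM (x - y)

end SpectralNorm

section SymmetricMatrix

variable {Ω : Type*} [MeasurableSpace Ω]

/-- `C` is a symmetric random matrix whose entries on and below the diagonal are independent, each
with values in some interval of length `τ`. This is all that the concentration of the spectral norm
uses about a sampling matrix. -/
structure IsIndepSymmMatrix (P : Measure Ω) (τ : ℝ) {n : ℕ}
    (C : Ω → Matrix (Fin n) (Fin n) ℝ) : Prop where
  aemeasurable_entry : ∀ i j, j ≤ i → AEMeasurable (fun ω => C ω i j) P
  symm : ∀ᵐ ω ∂P, (C ω).IsSymm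
  indep : iIndepFun (fun (ij : LowerIndex n) (ω : Ω) => C ω ij.1.1 ij.1.2) P
  mem_Icc : ∀ i j, j ≤ i → ∃ a, ∀ᵐ ω ∂P, C ω i j ∈ Set.Icc a (a + τ)

namespace IsIndepSymmMatrix

variable {P : Measure Ω} {τ : ℝ} {n : ℕ} {C : Ω → Matrix (Fin n) (Fin n) ℝ}

lemma mono (hC : IsIndepSymmMatrix P τ C) {τ' : ℝ} (hτ : τ ≤ τ') : IsIndepSymmMatrix P τ' C where
  aemeasurable_entry := hC.aemeasurable_entry
  symm := hC.symm
  indep := hC.indep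
  mem_Icc i j hij := (hC.mem_Icc i j hij).imp fun a ha =>
    ha.mono fun _ h => Set.Icc_subset_Icc_right (by linarith) h

lemma ae_specNorm_hadamardSymm_eq (hC : IsIndepSymmMatrix P τ C)
    (M : Matrix (Fin n) (Fin n) ℝ) : ∀ᵐ ω ∂P,
      specNorm (hadamardSymm M (WithLp.toLp 2 fun k : LowerIndex n => C ω k.1.1 k.1.2))
        = specNorm (M.hadamard (C ω)) :=
  hC.symm.mono fun _ hω => congrArg specNorm (hadamardSymm_lower M hω)

lemma aemeasurable_specNorm_hadamard (hC : IsIndepSymmMatrix P τ C)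
    (M : Matrix (Fin n) (Fin n) ℝ) : AEMeasurable (fun ω => specNorm (M.hadamard (C ω))) P := by
  have hlower : AEMeasurable (fun ω (k : LowerIndex n) => C ω k.1.1 k.1.2) P :=
    aemeasurable_pi_lambda _ fun k => hC.aemeasurable_entry _ _ k.2
  have hcont : Continuous fun x : LowerIndex n → ℝ =>
      specNorm (hadamardSymm M (WithLp.toLp 2 x)) :=
    (continuous_specNorm_hadamardSymm M).comp (PiLp.continuous_toLp 2 _)
  exact (hcont.measurable.comp_aemeasurable hlower).congr (hC.ae_specNorm_hadamardSymm_eq M)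

variable [IsProbabilityMeasure P] {M : Matrix (Fin n) (Fin n) ℝ} {b : ℝ}

lemma measureReal_specNorm_hadamard_le_mul_ge_le_exp (hC : IsIndepSymmMatrix P τ C) (hτ : 0 < τ)
    (hM : ∀ i j, |M i j| ≤ b) (hb : 0 ≤ b) (c : ℝ) {t : ℝ} (ht : 0 ≤ t) :
    P.real {ω | specNorm (M.hadamard (C ω)) ≤ c} * P.real {ω | c + t ≤ specNorm (M.hadamard (C ω))}
      ≤ Real.exp (-(8 * (b * τ) ^ 2)⁻¹ * t ^ 2) := by
  lift b to ℝ≥0 using hb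
  choose a ha using fun k : LowerIndex n => hC.mem_Icc _ _ k.2
  have hconc := measureReal_le_mul_measureReal_ge_le_exp
    (fun k : LowerIndex n => hC.aemeasurable_entry _ _ k.2) hC.indep hτ
    (fun k => (add_sub_cancel_left (a k) τ).le) ha (convexOn_specNorm_hadamardSymm M)
    (lipschitzWith_specNorm_hadamardSymm hM) c ht
  have hle : {ω | specNorm (M.hadamard (C ω)) ≤ c} =ᵐ[P] {ω |
      specNorm (hadamardSymm M (WithLp.toLp 2 fun k : LowerIndex n => C ω k.1.1 k.1.2)) ≤ c} :=
    (hC.ae_specNorm_hadamardSymm_eq M).mono fun ω hω => congrArg (· ≤ c) hω.symm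
  have hge : {ω | c + t ≤ specNorm (M.hadamard (C ω))} =ᵐ[P] {ω | c + t
      ≤ specNorm (hadamardSymm M (WithLp.toLp 2 fun k : LowerIndex n => C ω k.1.1 k.1.2))} :=
    (hC.ae_specNorm_hadamardSymm_eq M).mono fun ω hω => congrArg (c + t ≤ ·) hω.symm
  rw [measureReal_congr hle, measureReal_congr hge]
  convert hconc using 2
  simp only [NNReal.coe_mul, Real.coe_sqrt, NNReal.coe_ofNat, mul_pow, Real.sq_sqrt zero_le_two]
  ring

variable {m : ℝ}

lemma measureReal_lt_abs_specNorm_hadamard_sub_le (hC : IsIndepSymmMatrix P τ C) (hτ : 0 < τ)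
    (hM : ∀ i j, |M i j| ≤ b) (hb : 0 ≤ b)
    (hm : IsMedian P (fun ω => specNorm (M.hadamard (C ω))) m) {t : ℝ} (ht : 0 ≤ t) :
    P.real {ω | t < |specNorm (M.hadamard (C ω)) - m|}
      ≤ 4 * Real.exp (-(8 * (b * τ) ^ 2)⁻¹ * t ^ 2) :=
  hm.measureReal_lt_abs_sub_le fun c =>
    hC.measureReal_specNorm_hadamard_le_mul_ge_le_exp hτ hM hb c ht

lemma integral_specNorm_hadamard_sq_le (hC : IsIndepSymmMatrix P τ C) (hτ : 0 < τ)
    (hM : ∀ i j, |M i j| ≤ b) (hb : 0 < b)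
    (hm : IsMedian P (fun ω => specNorm (M.hadamard (C ω))) m) :
    Integrable (fun ω => specNorm (M.hadamard (C ω)) ^ 2) P ∧
      ∫ ω, specNorm (M.hadamard (C ω)) ^ 2 ∂P
        ≤ m ^ 2 + 32 * (b * τ) ^ 2 + 8 * m * √(2 * Real.pi * (b * τ) ^ 2) := by
  refine (integral_sq_le_of_gaussian_tail_abs_sub (hC.aemeasurable_specNorm_hadamard M)
    (hm.nonneg fun _ => specNorm_nonneg _) (by positivity : 0 < 8 * (b * τ) ^ 2)
    fun t ht => hC.measureReal_lt_abs_specNorm_hadamard_sub_le hτ hM hb.le hm ht).imp_right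
    fun h => h.trans_eq ?_
  have hsqrt : √(Real.pi * (8 * (b * τ) ^ 2)) = 2 * √(2 * Real.pi * (b * τ) ^ 2) := by
    rw [show Real.pi * (8 * (b * τ) ^ 2) = 2 ^ 2 * (2 * Real.pi * (b * τ) ^ 2) by ring,
      Real.sqrt_mul (by positivity), Real.sqrt_sq zero_le_two]
  rw [hsqrt]
  ring

lemma integral_specNorm_hadamard_pow_three_le (hC : IsIndepSymmMatrix P τ C) (hτ : 0 < τ)
    (hM : ∀ i j, |M i j| ≤ b) (hb : 0 < b)
    (hm : IsMedian P (fun ω => specNorm (M.hadamard (C ω))) m) :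
    Integrable (fun ω => specNorm (M.hadamard (C ω)) ^ 3) P ∧
      ∫ ω, specNorm (M.hadamard (C ω)) ^ 3 ∂P
        ≤ 4 * m ^ 3 + 12 * √Real.pi * (8 * (b * τ) ^ 2) ^ (3 / 2 : ℝ) := by
  convert integral_pow_three_le_of_gaussian_tail_abs_sub (hC.aemeasurable_specNorm_hadamard M)
    (fun _ => specNorm_nonneg _) (hm.nonneg fun _ => specNorm_nonneg _)
    (by positivity : 0 < 8 * (b * τ) ^ 2)
    fun t ht => hC.measureReal_lt_abs_specNorm_hadamard_sub_le hτ hM hb.le hm ht using 3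
  norm_num

end IsIndepSymmMatrix

end SymmetricMatrix

section SamplingMatrix

variable {Ω : Type*} [MeasurableSpace Ω] {P : Measure Ω} {n : ℕ} {p : ℝ}

lemma abs_le_maxNorm (A : Matrix (Fin n) (Fin n) ℝ) (i j : Fin n) : |A i j| ≤ maxNorm A :=
  le_ciSup (f := fun ij : Fin n × Fin n => |A ij.1 ij.2|) (Set.finite_range _).bddAbove (i, j)

lemma maxNorm_nonneg (A : Matrix (Fin n) (Fin n) ℝ) : 0 ≤ maxNorm A :=
  Real.iSup_nonneg fun _ => abs_nonneg _

lemma sqrt_mul_sqrt_add_sqrt_eq_one_div (hp0 : 0 < p) (hp1 : p < 1) :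
    √((1 - p) / p) * (√((1 - p) / p) + √(p / (1 - p))) = 1 / p := by
  have : 0 < 1 - p := sub_pos.2 hp1
  have hprod : (1 - p) / p * (p / (1 - p)) = 1 := by field_simp
  rw [mul_add, Real.mul_self_sqrt (by positivity), ← Real.sqrt_mul (by positivity), hprod,
    Real.sqrt_one]
  field_simp
  ring

lemma errorMatrix_eq_hadamard (M C : Matrix (Fin n) (Fin n) ℝ) :
    errorMatrix p M C = (√((1 - p) / p) • M).hadamard C :=
  (Matrix.smul_hadamard ..).symm

lemma abs_sqrt_smul_le (M : Matrix (Fin n) (Fin n) ℝ) (i j : Fin n) :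
    |(√((1 - p) / p) • M) i j| ≤ √((1 - p) / p) * maxNorm M := by
  rw [Matrix.smul_apply, smul_eq_mul, abs_mul, abs_of_nonneg (Real.sqrt_nonneg _)]
  exact mul_le_mul_of_nonneg_left (abs_le_maxNorm M i j) (Real.sqrt_nonneg _)

namespace IsSamplingMatrix

variable {C : Ω → Matrix (Fin n) (Fin n) ℝ}

lemma ae_entry_eq_or_eq [IsProbabilityMeasure P] (hC : IsSamplingMatrix P p C) (hp0 : 0 < p)
    (hp1 : p < 1) {i j : Fin n} (hij : j ≤ i) :
    ∀ᵐ ω ∂P, C ω i j = √((1 - p) / p) ∨ C ω i j = -√(p / (1 - p)) := by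
  have : 0 < 1 - p := sub_pos.2 hp1
  have hmeas (x : ℝ) : MeasurableSet {ω | C ω i j = x} :=
    measurableSet_eq_fun (hC.measurable_entry i j) measurable_const
  have hlt : -√(p / (1 - p)) < √((1 - p) / p) :=
    (neg_nonpos.2 (Real.sqrt_nonneg _)).trans_lt (Real.sqrt_pos.2 (by positivity))
  have hdisj : Disjoint {ω | C ω i j = √((1 - p) / p)} {ω | C ω i j = -√(p / (1 - p))} :=
    Set.disjoint_left.2 fun ω hhigh hlow => hlt.ne (hlow.symm.trans hhigh)
  have hunion := measureReal_union (μ := P) hdisj (hmeas _)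
  rw [hC.prob_high i j hij, hC.prob_low i j hij, add_sub_cancel] at hunion
  have hcompl := probReal_compl_eq_one_sub (μ := P)
    ((hmeas √((1 - p) / p)).union (hmeas (-√(p / (1 - p)))))
  rwa [hunion, sub_self, measureReal_eq_zero_iff] at hcompl

lemma ae_entry_mem_Icc [IsProbabilityMeasure P] (hC : IsSamplingMatrix P p C) (hp0 : 0 < p)
    (hp1 : p < 1) {i j : Fin n} (hij : j ≤ i) :
    ∀ᵐ ω ∂P, C ω i j ∈ Set.Icc (-√(p / (1 - p))) √((1 - p) / p) := by
  have hle : -√(p / (1 - p)) ≤ √((1 - p) / p) :=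
    (neg_nonpos.2 (Real.sqrt_nonneg _)).trans (Real.sqrt_nonneg _)
  filter_upwards [hC.ae_entry_eq_or_eq hp0 hp1 hij] with ω hω
  rcases hω with h | h <;> simp only [h, Set.left_mem_Icc, Set.right_mem_Icc, hle]

lemma isIndepSymmMatrix [IsProbabilityMeasure P] (hC : IsSamplingMatrix P p C) (hp0 : 0 < p)
    (hp1 : p < 1) : IsIndepSymmMatrix P (√((1 - p) / p) + √(p / (1 - p))) C where
  aemeasurable_entry i j _ := (hC.measurable_entry i j).aemeasurable
  symm := hC.symm
  indep := hC.indep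
  mem_Icc i j hij := by
    refine ⟨-√(p / (1 - p)), ?_⟩
    rw [neg_add_cancel_comm_assoc]
    exact hC.ae_entry_mem_Icc hp0 hp1 hij

end IsSamplingMatrix

end SamplingMatrix

end Subsampling

open Subsampling

theorem mainTheorem6_general {Ω : Type*} [MeasurableSpace Ω] {P : Measure Ω}
    [IsProbabilityMeasure P] {n : ℕ} {M : Matrix (Fin n) (Fin n) ℝ} {b : ℝ} (hb : 0 ≤ b)
    (hM : ∀ i j, |M i j| ≤ b) {C : Ω → Matrix (Fin n) (Fin n) ℝ} {τ : ℝ} (hτ : 0 ≤ τ)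
    (hC : IsIndepSymmMatrix P τ C) {m : ℝ}
    (hm : IsMedian P (fun ω => specNorm (M.hadamard (C ω))) m) :
    (∀ t : ℝ, 0 ≤ t →
      P.real {ω | t < |specNorm (M.hadamard (C ω)) - m|}
        ≤ 4 * Real.exp (-(8 * (b * τ) ^ 2)⁻¹ * t ^ 2)) ∧
    (Integrable (fun ω => specNorm (M.hadamard (C ω)) ^ 2) P ∧
      ∫ ω, specNorm (M.hadamard (C ω)) ^ 2 ∂P
        ≤ m ^ 2 + 32 * (b * τ) ^ 2 + 8 * m * √(2 * Real.pi * (b * τ) ^ 2)) ∧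
    (Integrable (fun ω => specNorm (M.hadamard (C ω)) ^ 3) P ∧
      ∫ ω, specNorm (M.hadamard (C ω)) ^ 3 ∂P
        ≤ 4 * m ^ 3 + 12 * √Real.pi * (8 * (b * τ) ^ 2) ^ (3 / 2 : ℝ)) := by
  have le_at_zero {f : ℝ → ℝ} {x : ℝ} (hf : Continuous f) (hx : ∀ ε > 0, x ≤ f ε) : x ≤ f 0 :=
    ge_of_tendsto (hf.continuousWithinAt (s := Set.Ioi 0)) (eventually_mem_nhdsWithin.mono hx)
  -- The Gaussian moments need a positive variance: enlarge both bounds by `ε`, then let `ε → 0`.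
  have hC_add {ε : ℝ} (hε : 0 < ε) : IsIndepSymmMatrix P (τ + ε) C := hC.mono (by linarith)
  have hM_add {ε : ℝ} (hε : 0 < ε) (i j : Fin n) : |M i j| ≤ b + ε := (hM i j).trans (by linarith)
  have hsq {ε : ℝ} (hε : 0 < ε) := (hC_add hε).integral_specNorm_hadamard_sq_le
    (by linarith) (hM_add hε) (by linarith) hm
  have hcube {ε : ℝ} (hε : 0 < ε) := (hC_add hε).integral_specNorm_hadamard_pow_three_le
    (by linarith) (hM_add hε) (by linarith) hm
  refine ⟨fun t ht => ?_, ⟨(hsq one_pos).1, ?_⟩, ⟨(hcube one_pos).1, ?_⟩⟩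
  · rcases hτ.eq_or_lt with rfl | hτ
    · refine measureReal_le_one.trans ?_
      norm_num
    · exact hC.measureReal_lt_abs_specNorm_hadamard_sub_le hτ hM hb hm ht
  · simpa only [add_zero] using le_at_zero (by fun_prop) fun ε hε => (hsq hε).2
  · simpa only [add_zero] using le_at_zero (by fun_prop (disch := positivity))
      fun ε hε => (hcube hε).2

theorem mainTheorem6 {Ω : Type*} [MeasurableSpace Ω] (P : Measure Ω) [IsProbabilityMeasure P]
    {n : ℕ} (p : ℝ) (hp0 : 0 < p) (hp1 : p < 1)
    (M : Matrix (Fin n) (Fin n) ℝ)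
    (C : Ω → Matrix (Fin n) (Fin n) ℝ) (hC : Subsampling.IsSamplingMatrix P p C)
    (E : Ω → Matrix (Fin n) (Fin n) ℝ) (hE : ∀ ω, E ω = Subsampling.errorMatrix p M (C ω))
    (m : ℝ) (hm : Subsampling.IsMedian P (fun ω => Subsampling.specNorm (E ω)) m) :
    (∀ t : ℝ, 0 ≤ t →
      P.real {ω | t < |Subsampling.specNorm (E ω) - m|}
        ≤ 4 * Real.exp (-(p ^ 2 / (8 * Subsampling.maxNorm M ^ 2)) * t ^ 2)) ∧
    (Integrable (fun ω => Subsampling.specNorm (E ω) ^ 2) P ∧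
      ∫ ω, Subsampling.specNorm (E ω) ^ 2 ∂P
        ≤ m ^ 2 + 32 * (Subsampling.maxNorm M ^ 2 / p ^ 2)
          + 8 * m * √(2 * Real.pi * Subsampling.maxNorm M ^ 2 / p ^ 2)) ∧
    (Integrable (fun ω => Subsampling.specNorm (E ω) ^ 3) P ∧
      ∫ ω, Subsampling.specNorm (E ω) ^ 3 ∂P
        ≤ 4 * m ^ 3
          + 12 * √Real.pi * (8 * Subsampling.maxNorm M ^ 2 / p ^ 2) ^ (3 / 2 : ℝ)) := by
  obtain rfl : E = fun ω => errorMatrix p M (C ω) := funext hE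
  simp only [errorMatrix_eq_hadamard] at hm ⊢
  have hσ : √((1 - p) / p) * maxNorm M * (√((1 - p) / p) + √(p / (1 - p))) = maxNorm M / p := by
    rw [mul_right_comm, sqrt_mul_sqrt_add_sqrt_eq_one_div hp0 hp1, one_div_mul_eq_div]
  have hgeneral := mainTheorem6_general (mul_nonneg (Real.sqrt_nonneg _) (maxNorm_nonneg M))
    (abs_sqrt_smul_le M) (by positivity) (hC.isIndepSymmMatrix hp0 hp1) hm
  simpa only [hσ, div_pow, ← mul_div_assoc, inv_div] using hgeneral
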